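/- Let $X=(X_t)_{t\ge 0}$ be a L\'evy process in $\mathbb R^d$ with characteristic exponent $\Psi$, i.e. $E[e^{-i\xi\cdot X_t}]=e^{-t\Psi(\xi)}$ for all $t\ge 0$, $\xi\in\mathbb R^d$. Suppose that for every $t>0$ the law of $X_t$ has a density $p_t$ and that $p_t\in L^2(\mathbb R^d)$. Let $\bar X_t=X_t-\tilde X_t$, where $\tilde X$ is an independent copy of $X$, and let $(\bar P_t\phi)(x)=E[\phi(x+\bar X_t)]$ be the semigroup of $\bar X$; for $t>0$ this equals $\int_{\mathbb R^d}\phi(y)\,\bar p_t(x-y)\,dy$ with $\bar p_t=p_t*\tilde p_t$, $\tilde p_t(y)=p_t(-y)$. Let $f:\mathbb R^d\to[0,\infty]$ be measurable and locally integrable, and suppose that $f$ is the Fourier transform, in the space of tempered distributions, of a tempered measure $\mu$, i.e. $\int f(x)\varphi(x)\,dx=\int \mathcal F\varphi(\xi)\,\mu(d\xi)$ for every Schwartz function $\varphi$, where $\mathcal F\varphi(\xi)=\int e^{-i\xi\cdot x}\varphi(x)\,dx$. Suppose that $\mu$ has a non-negative density with respect to Lebesgue measure, and that $f(x)<\infty$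 if and only if $x\neq 0$. Let $H>1/2$, $\alpha_H=H(2H-1)$, and for $\alpha>0$ and measurable $\phi\ge 0$ define $$(\bar R_{\alpha,H}\phi)(x)=\alpha_H\int_0^\infty\int_0^\infty |r-s|^{2H-2}e^{-\alpha(r+s)}(\bar P_{r+s}\phi)(x)\,dr\,ds .$$ Then for every $\alpha>0$, as an equality in $[0,\infty]$, $$(\bar R_{\alpha,H}f)(0)=\sup_{x\in\mathbb R^d}(\bar R_{\alpha,H}f)(x)=\Upsilon_H(\alpha):=\alpha_H\int_{\mathbb R^d}\int_0^\infty\int_0^\infty|r-s|^{2H-2}e^{-(\alpha+2\,\mathrm{Re}\,\Psi(\xi))(r+s)}\,dr\,ds\,\mu(d\xi).$$ -/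

import Mathlib

open MeasureTheory ProbabilityTheory Filter Topology
open scoped NNReal ENNReal SchwartzMap RealInnerProductSpace

noncomputable section

namespace FracMax

/-- The state space `ℝ^d`, with its Euclidean structure. -/
abbrev Rd (d : ℕ) : Type := EuclideanSpace ℝ (Fin d)

/-- A `d`-dimensional Lévy process: it starts at `0`, has independent and stationary increments,
is stochastically continuous, and almost all of its paths are right continuous with left limits. -/
structure IsLevyProcess {d : ℕ} {Ω : Type*} [MeasurableSpace Ω] (X : ℝ≥0 → Ω → Rd d)
    (P : Measure Ω) : Prop where
  measurable : ∀ t, Measurable (X t)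
  zero : ∀ᵐ ω ∂P, X 0 ω = 0
  indep_increments : HasIndepIncrements X P
  stationary_increments : ∀ s t : ℝ≥0,
    IdentDistrib (fun ω => X (s + t) ω - X s ω) (fun ω => X t ω - X 0 ω) P P
  stochastically_continuous : ∀ t : ℝ≥0, TendstoInMeasure P X (𝓝 t) (X t)
  cadlag : ∀ᵐ ω ∂P, ∀ t : ℝ≥0,
    Tendsto (fun s => X s ω) (𝓝[>] t) (𝓝 (X t ω)) ∧
      ∃ l : Rd d, Tendsto (fun s => X s ω) (𝓝[<] t) (𝓝 l)

/-- `Ψ` is the characteristic exponent of `X`: `E[exp(-i ξ·X_t)] = exp(-t Ψ(ξ))`. -/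
def IsCharExponent {d : ℕ} {Ω : Type*} [MeasurableSpace Ω] (X : ℝ≥0 → Ω → Rd d)
    (P : Measure Ω) (Ψ : Rd d → ℂ) : Prop :=
  ∀ (t : ℝ≥0) (ξ : Rd d),
    ∫ ω, Complex.exp (-(Complex.I * (⟪ξ, X t ω⟫ : ℝ))) ∂P = Complex.exp (-((t : ℝ) * Ψ ξ))

/-- The Fourier transform `(𝓕φ)(ξ) = ∫ exp(-i ξ·x) φ(x) dx`. -/
def fourier {d : ℕ} (φ : Rd d → ℂ) (ξ : Rd d) : ℂ :=
  ∫ x, Complex.exp (-(Complex.I * (⟪ξ, x⟫ : ℝ))) * φ x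

/-- A kernel: a measurable, locally integrable function with values in `[0, ∞]`. -/
structure IsKernel {d : ℕ} (f : Rd d → ℝ≥0∞) : Prop where
  measurable : Measurable f
  locally_integrable : ∀ K : Set (Rd d), IsCompact K → ∫⁻ x in K, f x < ∞

/-- `f` is the Fourier transform, in the space of tempered distributions, of the tempered
measure `μ`: `∫ f φ dx = ∫ 𝓕φ dμ` for every Schwartz function `φ`. The integrability of `f φ`
says that integration against `f` is defined on the whole Schwartz space. -/
structure IsFourierTransformOf {d : ℕ} (f : Rd d → ℝ≥0∞) (μ : Measure (Rd d)) : Prop where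
  tempered : μ.HasTemperateGrowth
  integrable : ∀ φ : 𝓢(Rd d, ℂ), Integrable (fun x => ((f x).toReal : ℂ) * φ x)
  eq : ∀ φ : 𝓢(Rd d, ℂ), ∫ x, ((f x).toReal : ℂ) * φ x = ∫ ξ, fourier φ ξ ∂μ

/-- The symmetrization `X̄_t = X_t - X̃_t`, where `X̃` is an independent copy of `X`; it lives on
the product space, which carries the measure `P.prod P`. -/
def symmetrization {d : ℕ} {Ω : Type*} (X : ℝ≥0 → Ω → Rd d) : ℝ≥0 → Ω × Ω → Rd d :=
  fun t ω => X t ω.1 - X t ω.2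

/-- The semigroup `(P_t φ)(x) = E[φ(x + X_t)]` of the process `X`, for non-negative `φ`. -/
def semigroup {d : ℕ} {Ω : Type*} [MeasurableSpace Ω] (X : ℝ≥0 → Ω → Rd d) (P : Measure Ω)
    (t : ℝ≥0) (φ : Rd d → ℝ≥0∞) (x : Rd d) : ℝ≥0∞ :=
  ∫⁻ ω, φ (x + X t ω) ∂P

/-- The semigroup `P̄_t` of the symmetrization `X̄`. -/
def symSemigroup {d : ℕ} {Ω : Type*} [MeasurableSpace Ω] (X : ℝ≥0 → Ω → Rd d) (P : Measure Ω)
    (t : ℝ≥0) (φ : Rd d → ℝ≥0∞) (x : Rd d) : ℝ≥0∞ :=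
  semigroup (symmetrization X) (P.prod P) t φ x

/-- The density `p̄_t = p_t * p̃_t` of `X̄_t`, where `p_t` is the density of `X_t` and
`p̃_t(y) = p_t(-y)`. -/
def symDensity {d : ℕ} {Ω : Type*} [MeasurableSpace Ω] (X : ℝ≥0 → Ω → Rd d) (P : Measure Ω)
    (t : ℝ≥0) (z : Rd d) : ℝ≥0∞ :=
  ∫⁻ w, pdf (X t) P volume (z - w) * pdf (X t) P volume (-w)

/-- The semigroup of `X̄` in terms of densities: `(P̄_t φ)(x) = ∫ φ(y) p̄_t(x - y) dy`. -/
theorem symSemigroup_eq {d : ℕ} {Ω : Type*} [MeasurableSpace Ω] (X : ℝ≥0 → Ω → Rd d)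
    (P : Measure Ω) [IsProbabilityMeasure P] (t : ℝ≥0) (hX : Measurable (X t))
    (hp : HasPDF (X t) P volume) (φ : Rd d → ℝ≥0∞) (hφ : Measurable φ) (x : Rd d) :
    symSemigroup X P t φ x = ∫⁻ y, φ y * symDensity X P t (x - y) := by
  have hm : Measurable (pdf (X t) P volume) := measurable_pdf _ _ _
  have key : ∀ g : Rd d → ℝ≥0∞, Measurable g →
      ∫⁻ ω, g (X t ω) ∂P = ∫⁻ u, pdf (X t) P volume u * g u := by
    intro g hg
    rw [← lintegral_map hg hX, map_eq_withDensity_pdf (X t) P volume,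
      lintegral_withDensity_eq_lintegral_mul _ hm hg]
    rfl
  have h1 : symSemigroup X P t φ x
      = ∫⁻ u, pdf (X t) P volume u * ∫⁻ v, pdf (X t) P volume v * φ (x + (u - v)) := by
    unfold symSemigroup semigroup symmetrization
    rw [lintegral_prod _ (by fun_prop)]
    have : ∀ ω, ∫⁻ ω', φ (x + (X t ω - X t ω')) ∂P
        = ∫⁻ v, pdf (X t) P volume v * φ (x + (X t ω - v)) :=
      fun ω => key (fun v => φ (x + (X t ω - v))) (by fun_prop)
    simp only [this]
    refine key (fun u => ∫⁻ v, pdf (X t) P volume v * φ (x + (u - v))) ?_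
    exact Measurable.lintegral_prod_right' (f := fun z : Rd d × Rd d =>
      pdf (X t) P volume z.2 * φ (x + (z.1 - z.2))) (by fun_prop)
  rw [h1]
  unfold symDensity
  have h2 : ∀ y, φ y * ∫⁻ w, pdf (X t) P volume (x - y - w) * pdf (X t) P volume (-w)
      = ∫⁻ w, φ y * (pdf (X t) P volume (x - y - w) * pdf (X t) P volume (-w)) :=
    fun y => (lintegral_const_mul _ (by fun_prop)).symm
  simp only [h2]
  rw [lintegral_lintegral_swap (by fun_prop),
    ← lintegral_neg_eq_self (μ := volume) (f := fun u => pdf (X t) P volume u *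
      ∫⁻ v, pdf (X t) P volume v * φ (x + (u - v)))]
  refine lintegral_congr fun w => ?_
  rw [← lintegral_const_mul _ (by fun_prop),
    ← lintegral_sub_left_eq_self (fun v => pdf (X t) P volume (-w) *
      (pdf (X t) P volume v * φ (x + (-w - v)))) (x - w)]
  refine lintegral_congr fun y => ?_
  have e1 : x + (-w - (x - w - y)) = y := by abel
  have e2 : x - y - w = x - w - y := by abel
  rw [e1, e2]
  ring

/-- The constant `α_H = H (2 H - 1)`. -/
def alphaH (H : ℝ) : ℝ := H * (2 * H - 1)

/-- The fractional resolvent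
`(R̄_{α,H} φ)(x) = α_H ∫_0^∞ ∫_0^∞ |r-s|^{2H-2} e^{-α(r+s)} (P̄_{r+s} φ)(x) dr ds`. -/
def fracResolvent {d : ℕ} {Ω : Type*} [MeasurableSpace Ω] (X : ℝ≥0 → Ω → Rd d) (P : Measure Ω)
    (H α : ℝ) (φ : Rd d → ℝ≥0∞) (x : Rd d) : ℝ≥0∞ :=
  ENNReal.ofReal (alphaH H) * ∫⁻ s in Set.Ioi (0 : ℝ), ∫⁻ r in Set.Ioi (0 : ℝ),
    ENNReal.ofReal (|r - s| ^ (2 * H - 2) * Real.exp (-(α * (r + s)))) *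
      symSemigroup X P (r + s).toNNReal φ x

/-- `Υ_H(α) = α_H ∫ ∫_0^∞ ∫_0^∞ |r-s|^{2H-2} e^{-(α + 2 Re Ψ(ξ))(r+s)} dr ds μ(dξ)`. -/
def upsilon {d : ℕ} (Ψ : Rd d → ℂ) (μ : Measure (Rd d)) (H α : ℝ) : ℝ≥0∞ :=
  ENNReal.ofReal (alphaH H) * ∫⁻ ξ, (∫⁻ s in Set.Ioi (0 : ℝ), ∫⁻ r in Set.Ioi (0 : ℝ),
    ENNReal.ofReal (|r - s| ^ (2 * H - 2) *
      Real.exp (-((α + 2 * (Ψ ξ).re) * (r + s))))) ∂μ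

end FracMax

end

noncomputable section

namespace FracMax

open scoped FourierTransform

variable {d : ℕ}

/-! Formally, `P̄_t f` is the Fourier transform of the positive measure `exp(-2t Re Ψ) dμ`. Such a
transform is largest in modulus at the origin, where it equals the total mass. Integrating in `(r,
s)` against a non-negative weight keeps the maximum at `0`, and Tonelli identifies the value there
with `Υ_H(α)`.

The work is to prove this formula at every point and every `t > 0`, although `f` is singular at `0`
and `μ` may be infinite. Positivity and duality make `f` uniformly locally integrable and `μ`
translation bounded. The `L²` hypothesis bounds the density of `X̄_t`, so `exp(-2t Re Ψ)` is
Lebesgue integrable. By `exponent_add_le` this function at time `2t` is controlled by its unit-ball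
averages at time `t`, hence is `μ`-integrable. Test functions then give the formula almost
everywhere (`lintegral_comp_add_ae_eq`), and one more convolution with an absolutely continuous law
gives it everywhere (`lintegral_comp_add_eq`). -/

theorem norm_exp_neg_I_mul (r : ℝ) : ‖Complex.exp (-(Complex.I * (r : ℝ)))‖ = 1 := by
  rw [Complex.norm_exp]; simp

/-! ### Dilation, translation and modulation on Schwartz space. -/

/-- Dilation of Schwartz functions. -/
def dilation (d : ℕ) (c : ℝ) (hc : c ≠ 0) : 𝓢(Rd d, ℂ) →L[ℂ] 𝓢(Rd d, ℂ) :=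
  SchwartzMap.compCLMOfContinuousLinearEquiv ℂ
    (ContinuousLinearEquiv.smulLeft (R₁ := ℝ) (M₁ := Rd d) (Units.mk0 c hc))

theorem dilation_apply (c : ℝ) (hc : c ≠ 0) (φ : 𝓢(Rd d, ℂ)) (x : Rd d) :
    dilation d c hc φ x = φ (c • x) := rfl

theorem fourier_eq_fourierIntegral (φ : Rd d → ℂ) (ξ : Rd d) :
    fourier φ ξ = 𝓕 φ ((2 * Real.pi)⁻¹ • ξ) := by
  rw [Real.fourier_eq', fourier]
  refine integral_congr_ae (ae_of_all _ fun x => ?_)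
  simp only [smul_eq_mul, inner_smul_right]
  congr 2
  rw [real_inner_comm]
  push_cast
  have : (Real.pi : ℂ) ≠ 0 := by exact_mod_cast Real.pi_ne_zero
  field_simp

theorem two_pi_inv_ne_zero : (2 * Real.pi)⁻¹ ≠ 0 := by positivity

theorem fourier_eq_dilation (φ : 𝓢(Rd d, ℂ)) :
    fourier φ = dilation d _ two_pi_inv_ne_zero (𝓕 φ) := by
  ext ξ
  rw [fourier_eq_fourierIntegral, dilation_apply, SchwartzMap.fourier_coe]

theorem integrable_fourier (φ : 𝓢(Rd d, ℂ)) (μ : Measure (Rd d)) [μ.HasTemperateGrowth] :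
    Integrable (fourier φ) μ := by
  rw [fourier_eq_dilation]
  exact SchwartzMap.integrable _

/-- Every Schwartz function is the Fourier transform of a Schwartz function. -/
theorem exists_fourier_eq (b : 𝓢(Rd d, ℂ)) : ∃ φ : 𝓢(Rd d, ℂ), fourier φ = b := by
  refine ⟨𝓕⁻ (dilation d (2 * Real.pi) (by positivity) b), ?_⟩
  rw [fourier_eq_dilation, FourierTransform.fourier_fourierInv_eq]
  ext x
  rw [dilation_apply, dilation_apply, smul_smul, mul_inv_cancel₀ (by positivity), one_smul]

theorem fourier_comp_sub (φ : Rd d → ℂ) (a ξ : Rd d) :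
    fourier (fun x => φ (x - a)) ξ
      = Complex.exp (-(Complex.I * (⟪ξ, a⟫ : ℝ))) * fourier φ ξ := by
  unfold fourier
  rw [← integral_add_right_eq_self _ a, ← integral_const_mul]
  refine integral_congr_ae (ae_of_all _ fun x => ?_)
  simp only [add_sub_cancel_right, inner_add_right]
  rw [← mul_assoc, ← Complex.exp_add]
  congr 2
  push_cast
  ring

/-- Each derivative only gains a factor `I`, so all of them have modulus one. -/
theorem hasTemperateGrowth_cexp_I_mul :
    (fun r : ℝ => Complex.exp (Complex.I * r)).HasTemperateGrowth := by
  have hd : ∀ n : ℕ, iteratedDeriv n (fun r : ℝ => Complex.exp (Complex.I * r))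
      = fun r : ℝ => Complex.I ^ n * Complex.exp (Complex.I * r) := by
    intro n
    induction n with
    | zero => simp
    | succ n ih =>
      rw [iteratedDeriv_succ, ih]
      ext r
      have h := ((((hasDerivAt_id (r : ℂ)).const_mul Complex.I).cexp).const_mul
        (Complex.I ^ n)).comp_ofReal
      simp only [id_eq] at h
      rw [h.deriv]
      ring
  refine ⟨(contDiff_const.mul Complex.ofRealCLM.contDiff).cexp, fun n => ⟨0, 1, fun x => ?_⟩⟩
  rw [norm_iteratedFDeriv_eq_norm_iteratedDeriv, hd, norm_mul, norm_pow, Complex.norm_exp]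
  simp

/-- Modulation of Schwartz functions. -/
theorem exists_modulation (φ : 𝓢(Rd d, ℂ)) (η : Rd d) : ∃ φ' : 𝓢(Rd d, ℂ),
    (∀ ξ, fourier φ' ξ = fourier φ (ξ - η)) ∧ ∀ x, ‖φ' x‖ = ‖φ x‖ := by
  have hg : (fun x : Rd d => Complex.exp (Complex.I * (⟪η, x⟫ : ℝ))).HasTemperateGrowth := by
    exact hasTemperateGrowth_cexp_I_mul.comp
      (Function.hasTemperateGrowth_inner_right η)
  refine ⟨SchwartzMap.smulLeftCLM ℂ (fun x : Rd d => Complex.exp (Complex.I * (⟪η, x⟫ : ℝ))) φ,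
    fun ξ => ?_, fun x => ?_⟩
  · refine integral_congr_ae (ae_of_all _ fun x => ?_)
    simp only [SchwartzMap.smulLeftCLM_apply_apply hg, smul_eq_mul, inner_sub_left]
    rw [← mul_assoc, ← Complex.exp_add]
    congr 2
    push_cast
    ring
  · rw [SchwartzMap.smulLeftCLM_apply_apply hg, norm_smul, Complex.norm_exp]
    simp

/-! ### Uniform local bounds for the kernel and its spectral measure. -/

section Kernel

variable {f : Rd d → ℝ≥0∞} {μ : Measure (Rd d)}

theorem IsKernel.ae_finite (hf : IsKernel f) : ∀ᵐ x, f x < ∞ := by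
  have h : ∀ n : ℕ, ∀ᵐ x ∂(volume.restrict (Metric.closedBall (0 : Rd d) n)), f x < ∞ := fun n =>
    ae_lt_top hf.measurable (hf.locally_integrable _ (isCompact_closedBall _ _)).ne
  have := (ae_restrict_iUnion_iff (fun n : ℕ => Metric.closedBall (0 : Rd d) n) _).2 h
  rwa [Metric.iUnion_closedBall_nat, Measure.restrict_univ] at this

/-- A translate of `f` costs only a unimodular phase on the spectral side; this is the source of all
bounds uniform in `a`. -/
theorem IsFourierTransformOf.integral_comp_add (h : IsFourierTransformOf f μ)
    (φ : 𝓢(Rd d, ℂ)) (a : Rd d) :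
    ∫ y, ((f (a + y)).toReal : ℂ) * φ y
      = ∫ ξ, Complex.exp (-(Complex.I * (⟪ξ, a⟫ : ℝ))) * fourier φ ξ ∂μ := by
  rw [← integral_sub_right_eq_self _ a]
  have := h.eq (φ.compSubConstCLM ℂ a)
  simp only [SchwartzMap.compSubConstCLM_apply] at this
  simp only [add_sub_cancel]
  rw [this]
  refine integral_congr_ae (ae_of_all _ fun ξ => ?_)
  exact fourier_comp_sub φ a ξ

theorem IsFourierTransformOf.integrable_comp_add (h : IsFourierTransformOf f μ)
    (φ : 𝓢(Rd d, ℂ)) (a : Rd d) :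
    Integrable fun y => ((f (a + y)).toReal : ℂ) * φ y := by
  have := (h.integrable (φ.compSubConstCLM ℂ a)).comp_add_left a
  simpa [SchwartzMap.compSubConstCLM_apply] using this

/-- A real smooth compactly supported function as a complex Schwartz function. -/
theorem exists_schwartz_of_hasCompactSupport {g : Rd d → ℝ} (hg : ContDiff ℝ (⊤ : ℕ∞) g)
    (hc : HasCompactSupport g) : ∃ φ : 𝓢(Rd d, ℂ), ∀ x, φ x = g x :=
  ⟨(hc.comp_left (g := Complex.ofRealCLM) rfl).toSchwartzMap
    (Complex.ofRealCLM.contDiff.comp hg), fun _ => rfl⟩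

/-- The kernel is uniformly locally integrable. -/
theorem exists_setLIntegral_comp_add_le (hf : IsKernel f) (h : IsFourierTransformOf f μ)
    (R : ℝ) : ∃ M : ℝ≥0∞, M < ∞ ∧
      ∀ a, ∫⁻ y in Metric.closedBall (0 : Rd d) R, f (a + y) ≤ M := by
  have := h.tempered
  -- The radius `|R| + 1` stays positive when `R ≤ 0`.
  let χ : ContDiffBump (0 : Rd d) := ⟨|R| + 1, |R| + 2, by positivity, by linarith⟩
  obtain ⟨φ, hφ⟩ := exists_schwartz_of_hasCompactSupport χ.contDiff χ.hasCompactSupport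
  refine ⟨ENNReal.ofReal (∫ ξ, ‖fourier φ ξ‖ ∂μ), ENNReal.ofReal_lt_top, fun a => ?_⟩
  have hfin : ∀ᵐ y, f (a + y) < ∞ :=
    (quasiMeasurePreserving_add_left volume a).ae hf.ae_finite
  have hint : Integrable fun y => (f (a + y)).toReal * χ y := by
    have := (h.integrable_comp_add φ a).re
    simpa [hφ] using this
  calc ∫⁻ y in Metric.closedBall (0 : Rd d) R, f (a + y)
      ≤ ∫⁻ y in Metric.closedBall (0 : Rd d) R, ENNReal.ofReal ((f (a + y)).toReal * χ y) := by
        refine lintegral_mono_ae ?_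
        filter_upwards [ae_restrict_of_ae hfin,
          ae_restrict_mem Metric.isClosed_closedBall.measurableSet] with y hy hyR
        rw [χ.one_of_mem_closedBall (Metric.closedBall_subset_closedBall
          (show R ≤ |R| + 1 by linarith [le_abs_self R]) hyR), mul_one, ENNReal.ofReal_toReal hy.ne]
    _ ≤ ∫⁻ y, ENNReal.ofReal ((f (a + y)).toReal * χ y) := setLIntegral_le_lintegral _ _
    _ = ENNReal.ofReal (∫ y, (f (a + y)).toReal * χ y) :=
        (ofReal_integral_eq_lintegral_ofReal hint
          (ae_of_all _ fun y => mul_nonneg ENNReal.toReal_nonneg χ.nonneg)).symm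
    _ ≤ ENNReal.ofReal (∫ ξ, ‖fourier φ ξ‖ ∂μ) := by
        refine ENNReal.ofReal_le_ofReal ?_
        have e := h.integral_comp_add φ a
        have e2 : ∫ y, ((f (a + y)).toReal : ℂ) * φ y
            = ((∫ y, (f (a + y)).toReal * χ y : ℝ) : ℂ) := by
          rw [← integral_complex_ofReal]
          simp [hφ]
        rw [e2] at e
        calc ∫ y, (f (a + y)).toReal * χ y
            ≤ ‖((∫ y, (f (a + y)).toReal * χ y : ℝ) : ℂ)‖ := by
              rw [Complex.norm_real]; exact le_abs_self _
          _ ≤ _ := by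
              rw [e]
              refine (norm_integral_le_integral_norm _).trans_eq ?_
              simp only [norm_mul, norm_exp_neg_I_mul, one_mul]

/-- The spectral measure is translation bounded. -/
theorem exists_measure_closedBall_le (h : IsFourierTransformOf f μ) :
    ∃ M : ℝ≥0∞, M < ∞ ∧ ∀ η, μ (Metric.closedBall η 1) ≤ M := by
  have := h.tempered
  let χ : ContDiffBump (0 : Rd d) := ⟨1, 2, by positivity, by linarith⟩
  obtain ⟨b, hb⟩ := exists_schwartz_of_hasCompactSupport χ.contDiff χ.hasCompactSupport
  -- The bump is placed on the frequency side: modulating `φ` moves it to `η` without changing `‖φ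
  -- x‖`, so the bound does not depend on `η`.
  obtain ⟨φ, hφ⟩ := exists_fourier_eq b
  refine ⟨ENNReal.ofReal (∫ x, ‖((f x).toReal : ℂ) * φ x‖), ENNReal.ofReal_lt_top, fun η => ?_⟩
  obtain ⟨φ', h1, h2⟩ := exists_modulation φ η
  have h3 : ∀ ξ, fourier φ' ξ = (χ (ξ - η) : ℝ) := fun ξ => by rw [h1, hφ, hb]
  have hint : Integrable (fun ξ => χ (ξ - η)) μ := by
    have := (integrable_fourier φ' μ).re
    simpa [h3] using this
  calc μ (Metric.closedBall η 1)
      = ∫⁻ ξ in Metric.closedBall η 1, 1 ∂μ := by simp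
    _ ≤ ∫⁻ ξ in Metric.closedBall η 1, ENNReal.ofReal (χ (ξ - η)) ∂μ := by
        refine setLIntegral_mono (ENNReal.measurable_ofReal.comp
          (χ.continuous.measurable.comp (measurable_id.sub_const η))) fun ξ hξ => ?_
        rw [χ.one_of_mem_closedBall]
        · simp
        · simpa [dist_eq_norm] using hξ
    _ ≤ ∫⁻ ξ, ENNReal.ofReal (χ (ξ - η)) ∂μ := setLIntegral_le_lintegral _ _
    _ = ENNReal.ofReal (∫ ξ, χ (ξ - η) ∂μ) :=
        (ofReal_integral_eq_lintegral_ofReal hint (ae_of_all _ fun y => χ.nonneg)).symm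
    _ ≤ _ := by
        refine ENNReal.ofReal_le_ofReal ?_
        have e := h.eq φ'
        simp only [h3] at e
        rw [integral_complex_ofReal] at e
        calc ∫ ξ, χ (ξ - η) ∂μ ≤ ‖((∫ ξ, χ (ξ - η) ∂μ : ℝ) : ℂ)‖ := by
              rw [Complex.norm_real]; exact le_abs_self _
          _ ≤ _ := by
              rw [← e]
              refine (norm_integral_le_integral_norm _).trans_eq ?_
              simp only [norm_mul, h2]

end Kernel

/-! ### Symmetric families: growth and integrability of the exponent. -/

/-- `ν` is a family of probability measures with characteristic functions `exp(-2tψ)`. -/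
structure IsSymFamily (ν : ℝ≥0 → Measure (Rd d)) (ψ : Rd d → ℝ) : Prop where
  prob : ∀ t, IsProbabilityMeasure (ν t)
  charFun_eq : ∀ (t : ℝ≥0) ξ, charFun (ν t) ξ = (Real.exp (-(2 * t * ψ ξ)) : ℝ)

/-- Since `1 - cos θ = |1 - e^{iθ}|² / 2`, this is the triangle inequality followed by `(x + y)² ≤
2x² + 2y²`. -/
theorem one_sub_cos_add_le (a b : ℝ) :
    1 - Real.cos (a + b) ≤ 2 * (1 - Real.cos a) + 2 * (1 - Real.cos b) := by
  rw [Real.cos_add]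
  nlinarith [Real.sin_sq_add_cos_sq a, Real.sin_sq_add_cos_sq b,
    sq_nonneg (Real.sin a - Real.sin b), sq_nonneg (Real.cos a + Real.cos b - 2),
    Real.cos_le_one a, Real.cos_le_one b, sq_nonneg (Real.sin a + Real.sin b),
    mul_nonneg (sub_nonneg.2 (Real.cos_le_one a)) (sub_nonneg.2 (Real.cos_le_one b)),
    sq_nonneg (Real.cos a - Real.cos b)]

/-- Divide by `t` and let `t` decrease to `0`. -/
theorem le_of_one_sub_exp_le {a b c : ℝ} (h : ∀ t : ℝ, 0 < t →
    1 - Real.exp (-(t * a)) ≤ 2 * (1 - Real.exp (-(t * b))) + 2 * (1 - Real.exp (-(t * c)))) :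
    a ≤ 2 * b + 2 * c := by
  have hd : ∀ u : ℝ, HasDerivAt (fun t : ℝ => 1 - Real.exp (-(t * u))) u 0 := fun u => by
    have := ((((hasDerivAt_id (0 : ℝ)).mul_const u).neg).exp).const_sub 1
    simpa using this
  have hg := (((hd b).const_mul 2).add ((hd c).const_mul 2)).sub (hd a)
  have hl := hg.tendsto_slope_zero_right
  refine sub_nonneg.1 (ge_of_tendsto hl ?_)
  filter_upwards [self_mem_nhdsWithin] with t ht
  have ht' : 0 < t := ht
  have := h t ht'
  simp only [Pi.add_apply, Pi.sub_apply, zero_add, zero_mul, neg_zero, Real.exp_zero, sub_self,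
    mul_zero, add_zero, sub_zero, smul_eq_mul]
  exact mul_nonneg (inv_nonneg.2 ht'.le) (by linarith)

namespace IsSymFamily

variable {ν : ℝ≥0 → Measure (Rd d)} {ψ : Rd d → ℝ}

theorem integral_cos (h : IsSymFamily ν ψ) (t : ℝ≥0) (ξ : Rd d) :
    ∫ x, Real.cos ⟪x, ξ⟫ ∂(ν t) = Real.exp (-(2 * t * ψ ξ)) := by
  have := h.prob t
  have e := congrArg Complex.re (h.charFun_eq t ξ)
  rw [charFun_apply, Complex.ofReal_re] at e
  rw [← e]
  have hi : Integrable (fun x => Complex.exp ((⟪x, ξ⟫ : ℝ) * Complex.I)) (ν t) :=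
    Integrable.of_bound (by fun_prop) 1
      (ae_of_all _ fun x => by rw [Complex.norm_exp_ofReal_mul_I])
  have h2 := integral_re hi
  simp only [RCLike.re_to_complex, Complex.exp_ofReal_mul_I_re] at h2
  exact h2

/-- The cosine inequality is integrated against `ν s` and differentiated at time zero. -/
theorem exponent_add_le (h : IsSymFamily ν ψ) (ξ η : Rd d) :
    ψ (ξ + η) ≤ 2 * ψ ξ + 2 * ψ η := by
  refine le_of_one_sub_exp_le fun t ht => ?_
  obtain ⟨s, hs⟩ : ∃ s : ℝ≥0, 2 * (s : ℝ) = t :=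
    ⟨(t / 2).toNNReal, by rw [Real.coe_toNNReal _ (by positivity)]; ring⟩
  have key : ∀ ζ, ∫ x, Real.cos ⟪x, ζ⟫ ∂(ν s) = Real.exp (-(t * ψ ζ)) := fun ζ => by
    rw [h.integral_cos, hs]
  have := h.prob s
  have hi : ∀ ζ : Rd d, Integrable (fun x => Real.cos ⟪x, ζ⟫) (ν s) :=
    fun ζ => Integrable.of_bound (by fun_prop) 1
      (ae_of_all _ fun x => by simpa using Real.abs_cos_le_one _)
  have he : ∀ ζ : Rd d, 1 - Real.exp (-(t * ψ ζ))
      = ∫ x, (1 - Real.cos ⟪x, ζ⟫) ∂(ν s) := fun ζ => by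
    rw [integral_sub (integrable_const _) (hi ζ), key]
    simp
  rw [he, he, he, ← integral_const_mul, ← integral_const_mul, ← integral_add]
  · refine integral_mono ((integrable_const _).sub (hi _)) ?_ fun x => ?_
    · exact (((integrable_const _).sub (hi _)).const_mul _).add
        (((integrable_const _).sub (hi _)).const_mul _)
    · simp only [inner_add_right]
      exact one_sub_cos_add_le _ _
  · exact ((integrable_const _).sub (hi _)).const_mul _
  · exact ((integrable_const _).sub (hi _)).const_mul _

/-- The characteristic function at time one is continuous and positive, so its logarithm is
continuous. This supplies both measurability and local boundedness of `ψ`. -/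
theorem continuous_exponent (h : IsSymFamily ν ψ) : Continuous ψ := by
  have := h.prob 1
  have hc : Continuous fun ξ => (charFun (ν 1) ξ).re :=
    Complex.continuous_re.comp continuous_charFun
  simp only [h.charFun_eq, Complex.ofReal_re] at hc
  have := (hc.log fun ξ => (Real.exp_pos _).ne').div_const (-2)
  refine this.congr fun ξ => ?_
  rw [Real.log_exp]
  push_cast
  ring

theorem conv_self (h : IsSymFamily ν ψ) (s : ℝ≥0) : ν s ∗ ν s = ν (s + s) := by
  have := h.prob
  refine Measure.ext_of_charFun ?_
  ext ξ
  rw [charFun_conv, h.charFun_eq, h.charFun_eq, ← Complex.ofReal_mul, ← Real.exp_add]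
  congr 2
  push_cast
  ring

/-- If `ν t` has a bounded density, its characteristic function is integrable. -/
theorem lintegral_exp_lt_top (h : IsSymFamily ν ψ) (t : ℝ≥0) (C : ℝ≥0∞) (hC : C < ∞)
    (hν : ν t ≤ C • volume) :
    ∫⁻ ξ, ENNReal.ofReal (Real.exp (-(2 * t * ψ ξ))) < ∞ := by
  have := h.prob t
  have hm : Measurable ψ := h.continuous_exponent.measurable
  -- Gaussian regularization
  have hpos : ∀ n : ℕ, (0 : ℝ) < 1 / ((n : ℝ) + 1) := fun n => by positivity
  have hgc : ∀ b : ℝ, 0 < b → ∀ x : Rd d,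
      ∫ ξ : Rd d, Complex.exp (-b * ‖ξ‖ ^ 2 + Complex.I * (⟪x, ξ⟫ : ℝ))
        = ((Real.pi / b) ^ ((d : ℝ) / 2) * Real.exp (-(1 / (4 * b)) * ‖x‖ ^ 2) : ℝ) := by
    intro b hb x
    rw [GaussianFourier.integral_cexp_neg_mul_sq_norm_add (by simpa using hb)]
    push_cast
    rw [Complex.ofReal_cpow (by positivity)]
    push_cast
    simp only [finrank_euclideanSpace, Fintype.card_fin, Complex.I_sq]
    congr 2
    have : (b : ℂ) ≠ 0 := by exact_mod_cast hb.ne'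
    field_simp
  have bound : ∀ b : ℝ, 0 < b →
      ∫⁻ ξ : Rd d, ENNReal.ofReal (Real.exp (-b * ‖ξ‖ ^ 2) * Real.exp (-(2 * t * ψ ξ)))
        ≤ C * ENNReal.ofReal ((2 * Real.pi) ^ (d : ℝ)) := by
    intro b hb
    have hgi : Integrable fun ξ : Rd d => Real.exp (-b * ‖ξ‖ ^ 2) := by
      have := (GaussianFourier.integrable_cexp_neg_mul_sq_norm_add (V := Rd d)
        (b := (b : ℂ)) (by simpa using hb) 0 0).norm
      refine this.congr (ae_of_all _ fun ξ => ?_)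
      simp only [Complex.norm_exp]
      congr 1
      simp [← Complex.ofReal_pow, ← Complex.ofReal_neg, ← Complex.ofReal_mul]
    have hle : ∀ ξ, Real.exp (-(2 * t * ψ ξ)) ≤ 1 := fun ξ => by
      have := norm_charFun_le_one (μ := ν t) (t := ξ)
      rw [h.charFun_eq, Complex.norm_real] at this
      exact (le_abs_self _).trans this
    have hint : Integrable fun ξ : Rd d =>
        Real.exp (-b * ‖ξ‖ ^ 2) * Real.exp (-(2 * t * ψ ξ)) := by
      refine hgi.mono' (by fun_prop) (ae_of_all _ fun ξ => ?_)
      rw [Real.norm_of_nonneg (by positivity)]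
      exact mul_le_of_le_one_right (Real.exp_pos _).le (hle ξ)
    rw [← ofReal_integral_eq_lintegral_ofReal hint (ae_of_all _ fun ξ => by positivity)]
    -- Fubini moves the Fourier transform from `ν t` to the Gaussian.
    have e1 : ∫ ξ : Rd d, Real.exp (-b * ‖ξ‖ ^ 2) * Real.exp (-(2 * t * ψ ξ))
        = ∫ x, (Real.pi / b) ^ ((d : ℝ) / 2) * Real.exp (-(1 / (4 * b)) * ‖x‖ ^ 2) ∂(ν t) := by
      apply Complex.ofReal_injective
      rw [← integral_complex_ofReal, ← integral_complex_ofReal]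
      simp only [← hgc b hb]
      rw [integral_integral_swap]
      · refine integral_congr_ae (ae_of_all _ fun ξ => ?_)
        simp only [Complex.exp_add]
        rw [integral_const_mul, Complex.ofReal_mul, ← h.charFun_eq, charFun_apply]
        simp [mul_comm]
      · have := (hgi.ofReal (𝕜 := ℂ)).comp_snd (ν t)
        refine this.mono (by fun_prop) (ae_of_all _ fun z => ?_)
        simp [Function.uncurry, Complex.exp_add, Complex.norm_exp, ← Complex.ofReal_pow,
          ← Complex.ofReal_neg, ← Complex.ofReal_mul]
    rw [e1, ofReal_integral_eq_lintegral_ofReal]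
    rotate_left
    · refine Integrable.of_bound (by fun_prop) ((Real.pi / b) ^ ((d : ℝ) / 2))
        (ae_of_all _ fun x => ?_)
      rw [Real.norm_of_nonneg (by positivity)]
      refine mul_le_of_le_one_right (by positivity) (Real.exp_le_one_iff.2 ?_)
      have : 0 < 1 / (4 * b) := by positivity
      nlinarith [sq_nonneg ‖x‖]
    · exact ae_of_all _ fun x => by positivity
    calc _ ≤ ∫⁻ x, ENNReal.ofReal ((Real.pi / b) ^ ((d : ℝ) / 2) *
          Real.exp (-(1 / (4 * b)) * ‖x‖ ^ 2)) ∂(C • volume) := lintegral_mono' hν le_rfl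
      _ = _ := by
        have hb4 : 0 < 1 / (4 * b) := by positivity
        rw [lintegral_smul_measure, ← ofReal_integral_eq_lintegral_ofReal, integral_const_mul,
          GaussianFourier.integral_rexp_neg_mul_sq_norm hb4, smul_eq_mul]
        · congr 2
          simp only [finrank_euclideanSpace, Fintype.card_fin]
          rw [← Real.mul_rpow (by positivity) (by positivity)]
          -- The powers of `b` cancel, so the bound survives `b → 0`.
          have : Real.pi / b * (Real.pi / (1 / (4 * b))) = (2 * Real.pi) ^ 2 := by
            field_simp; ring
          rw [this, ← Real.rpow_natCast, ← Real.rpow_mul (by positivity)]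
          congr 1
          push_cast
          ring
        · refine Integrable.const_mul ?_ _
          have := (GaussianFourier.integrable_cexp_neg_mul_sq_norm_add (V := Rd d)
            (b := ((1 / (4 * b) : ℝ) : ℂ)) (by simpa using hb) 0 0).norm
          refine this.congr (ae_of_all _ fun ξ => ?_)
          simp only [Complex.norm_exp]
          congr 1
          simp only [zero_mul, add_zero, ← Complex.ofReal_pow, ← Complex.ofReal_neg,
            ← Complex.ofReal_mul, Complex.ofReal_re]
        · exact ae_of_all _ fun x => by positivity
  have lim : ∀ ξ : Rd d, Tendsto (fun n : ℕ => ENNReal.ofReal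
      (Real.exp (-(1 / ((n : ℝ) + 1)) * ‖ξ‖ ^ 2) * Real.exp (-(2 * t * ψ ξ)))) atTop
      (𝓝 (ENNReal.ofReal (Real.exp (-(2 * t * ψ ξ))))) := by
    intro ξ
    refine ENNReal.tendsto_ofReal ?_
    have h1 : Tendsto (fun n : ℕ => -(1 / ((n : ℝ) + 1)) * ‖ξ‖ ^ 2) atTop (𝓝 0) := by
      simpa using (tendsto_one_div_add_atTop_nhds_zero_nat (𝕜 := ℝ)).neg.mul_const (‖ξ‖ ^ 2)
    simpa using ((Real.continuous_exp.tendsto 0).comp h1).mul_const (Real.exp (-(2 * t * ψ ξ)))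
  -- Fatou's lemma along `b = 1 / (n + 1)` removes the Gaussian.
  calc ∫⁻ ξ, ENNReal.ofReal (Real.exp (-(2 * t * ψ ξ)))
      = ∫⁻ ξ : Rd d, liminf (fun n : ℕ => ENNReal.ofReal
      (Real.exp (-(1 / ((n : ℝ) + 1)) * ‖ξ‖ ^ 2) * Real.exp (-(2 * t * ψ ξ)))) atTop :=
        lintegral_congr fun ξ => (lim ξ).liminf_eq.symm
    _ ≤ liminf (fun n : ℕ => ∫⁻ ξ : Rd d, ENNReal.ofReal
      (Real.exp (-(1 / ((n : ℝ) + 1)) * ‖ξ‖ ^ 2) * Real.exp (-(2 * t * ψ ξ)))) atTop :=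
        lintegral_liminf_le fun n => by fun_prop
    _ ≤ C * ENNReal.ofReal ((2 * Real.pi) ^ (d : ℝ)) :=
        liminf_le_of_le (by isBoundedDefault) fun b hb => by
          obtain ⟨n, hn⟩ := hb.exists
          exact hn.trans (bound _ (hpos n))
    _ < ∞ := ENNReal.mul_lt_top hC ENNReal.ofReal_lt_top

/-- The characteristic functions are integrable against translation bounded measures. -/
theorem lintegral_exp_lt_top_of_translation_bounded (h : IsSymFamily ν ψ) (t : ℝ≥0)
    {μ : Measure (Rd d)} [SFinite μ] {M : ℝ≥0∞} (hM : M < ∞)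
    (hμ : ∀ η, μ (Metric.closedBall η 1) ≤ M)
    (ht : ∫⁻ ξ, ENNReal.ofReal (Real.exp (-(2 * t * ψ ξ))) < ∞) :
    ∫⁻ ξ, ENNReal.ofReal (Real.exp (-(2 * (t + t : ℝ≥0) * ψ ξ))) ∂μ < ∞ := by
  have hm : Measurable ψ := h.continuous_exponent.measurable
  obtain ⟨K, hK⟩ := ((isCompact_closedBall (0 : Rd d) 1).image
    h.continuous_exponent).bddAbove
  have hK' : ∀ ζ : Rd d, ‖ζ‖ ≤ 1 → ψ ζ ≤ K := fun ζ hζ =>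
    hK ⟨ζ, by simpa using hζ, rfl⟩
  set B := Metric.closedBall (0 : Rd d) 1
  let c : ℝ≥0∞ := ENNReal.ofReal (Real.exp (4 * t * K))
  -- For `|η - ξ| ≤ 1`, `ψ η ≤ 2 ψ ξ + 2K`. The factor 2 on `ψ ξ` is why time doubles, and `2K`
  -- produces `c`. Averaging over `η` then trades `μ` for Lebesgue measure.
  have hpt : ∀ ξ, ENNReal.ofReal (Real.exp (-(2 * (t + t : ℝ≥0) * ψ ξ))) * volume B
      ≤ ∫⁻ η, (Metric.closedBall η 1).indicator 1 ξ *
        (c * ENNReal.ofReal (Real.exp (-(2 * t * ψ η)))) := by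
    intro ξ
    have hB : volume B = volume (Metric.closedBall ξ 1) :=
      (Measure.addHaar_closedBall_center volume ξ 1).symm
    rw [hB, ← setLIntegral_const, ← lintegral_indicator Metric.isClosed_closedBall.measurableSet]
    refine lintegral_mono fun η => ?_
    by_cases hη : η ∈ Metric.closedBall ξ 1
    · have hξ : ξ ∈ Metric.closedBall η 1 := by rwa [Metric.mem_closedBall_comm]
      rw [Set.indicator_of_mem hη, Set.indicator_of_mem hξ, Pi.one_apply, one_mul,
        ← ENNReal.ofReal_mul (Real.exp_pos _).le, ← Real.exp_add]
      refine ENNReal.ofReal_le_ofReal (Real.exp_le_exp.2 ?_)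
      have h1 := h.exponent_add_le ξ (η - ξ)
      have h2 := hK' (η - ξ) (by simpa [dist_eq_norm] using hη)
      rw [add_sub_cancel] at h1
      push_cast
      have ht0 : (0 : ℝ) ≤ t := t.2
      nlinarith [mul_le_mul_of_nonneg_left h1 ht0, mul_le_mul_of_nonneg_left h2 ht0]
    · rw [Set.indicator_of_notMem hη]
      exact zero_le
  have hBpos : volume B ≠ 0 := (Metric.measure_closedBall_pos volume _ one_pos).ne'
  have hmul : (∫⁻ ξ, ENNReal.ofReal (Real.exp (-(2 * (t + t : ℝ≥0) * ψ ξ))) ∂μ) * volume B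
      < ∞ := by
    rw [← lintegral_mul_const _ (by fun_prop)]
    refine (lintegral_mono hpt).trans_lt ?_
    have hset : MeasurableSet {z : Rd d × Rd d | dist z.1 z.2 ≤ 1} :=
      measurableSet_le (by fun_prop) measurable_const
    have hind : Measurable fun z : Rd d × Rd d =>
        (Metric.closedBall z.2 1).indicator (1 : Rd d → ℝ≥0∞) z.1 :=
      (measurable_one.indicator hset : Measurable
        ({z : Rd d × Rd d | dist z.1 z.2 ≤ 1}.indicator (1 : Rd d × Rd d → ℝ≥0∞)))
    rw [lintegral_lintegral_swap (by fun_prop)]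
    calc ∫⁻ η, ∫⁻ ξ, (Metric.closedBall η 1).indicator 1 ξ *
          (c * ENNReal.ofReal (Real.exp (-(2 * t * ψ η)))) ∂μ
        = ∫⁻ η, μ (Metric.closedBall η 1) *
          (c * ENNReal.ofReal (Real.exp (-(2 * t * ψ η)))) := by
          refine lintegral_congr fun η => ?_
          rw [lintegral_mul_const _
            (measurable_one.indicator Metric.isClosed_closedBall.measurableSet),
            lintegral_indicator_one Metric.isClosed_closedBall.measurableSet]
      _ ≤ ∫⁻ η, M * (c * ENNReal.ofReal (Real.exp (-(2 * t * ψ η)))) :=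
          lintegral_mono fun η => by gcongr; exact hμ η
      _ = M * (c * ∫⁻ η, ENNReal.ofReal (Real.exp (-(2 * t * ψ η)))) := by
          rw [lintegral_const_mul _ (by fun_prop), lintegral_const_mul _ (by fun_prop)]
      _ < ∞ := ENNReal.mul_lt_top hM (ENNReal.mul_lt_top ENNReal.ofReal_lt_top ht)
  exact ENNReal.lt_top_of_mul_ne_top_left hmul.ne hBpos

end IsSymFamily

/-! ### The spectral formula for `f` averaged against `ν`. -/

/-- The Fourier transform of the measure `exp(-2sψ) dμ`. -/
def dampedFourier (ψ : Rd d → ℝ) (μ : Measure (Rd d)) (s : ℝ≥0) (x : Rd d) : ℂ :=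
  ∫ ξ, Complex.exp (-(Complex.I * (⟪ξ, x⟫ : ℝ))) * (Real.exp (-(2 * s * ψ ξ)) : ℝ) ∂μ

/-- The bound is the value at the origin: this is the maximum principle. -/
theorem norm_dampedFourier_le (ψ : Rd d → ℝ) (μ : Measure (Rd d)) (s : ℝ≥0) (x : Rd d) :
    ‖dampedFourier ψ μ s x‖ ≤ ∫ ξ, Real.exp (-(2 * s * ψ ξ)) ∂μ := by
  refine (norm_integral_le_integral_norm _).trans_eq ?_
  refine integral_congr_ae (ae_of_all _ fun ξ => ?_)
  simp only [norm_mul, norm_exp_neg_I_mul, one_mul, Complex.norm_real, Real.norm_of_nonneg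
    (Real.exp_pos _).le]

theorem dampedFourier_zero (ψ : Rd d → ℝ) (μ : Measure (Rd d)) (s : ℝ≥0) :
    dampedFourier ψ μ s 0 = (∫ ξ, Real.exp (-(2 * s * ψ ξ)) ∂μ : ℝ) := by
  simp only [dampedFourier, inner_zero_right, Complex.ofReal_zero, mul_zero, neg_zero,
    Complex.exp_zero, one_mul]
  exact integral_ofReal

namespace IsSymFamily

variable {ν : ℝ≥0 → Measure (Rd d)} {ψ : Rd d → ℝ} {f : Rd d → ℝ≥0∞} {μ : Measure (Rd d)}

theorem integral_exp_neg (h : IsSymFamily ν ψ) (t : ℝ≥0) (ξ : Rd d) :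
    ∫ x, Complex.exp (-(Complex.I * (⟪ξ, x⟫ : ℝ))) ∂(ν t) = (Real.exp (-(2 * t * ψ ξ)) : ℝ) := by
  have e := congrArg (starRingEnd ℂ) (h.charFun_eq t ξ)
  rw [← charFun_neg, Complex.conj_ofReal] at e
  rw [← e, charFun_apply]
  refine integral_congr_ae (ae_of_all _ fun x => ?_)
  simp only [inner_neg_right, real_inner_comm]
  congr 1
  push_cast
  ring

theorem integrable_exp (h : IsSymFamily ν ψ) {s : ℝ≥0}
    (hs : ∫⁻ ξ, ENNReal.ofReal (Real.exp (-(2 * s * ψ ξ))) ∂μ < ∞) :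
    Integrable (fun ξ => Real.exp (-(2 * s * ψ ξ))) μ := by
  have hm : Measurable ψ := h.continuous_exponent.measurable
  refine ⟨by fun_prop, ?_⟩
  rwa [hasFiniteIntegral_iff_ofReal (ae_of_all _ fun ξ => by positivity)]

theorem continuous_dampedFourier (h : IsSymFamily ν ψ) {s : ℝ≥0}
    (hs : ∫⁻ ξ, ENNReal.ofReal (Real.exp (-(2 * s * ψ ξ))) ∂μ < ∞) :
    Continuous (dampedFourier ψ μ s) := by
  have hm : Measurable ψ := h.continuous_exponent.measurable
  refine continuous_of_dominated (bound := fun ξ => Real.exp (-(2 * s * ψ ξ)))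
    (fun x => by fun_prop) (fun x => ae_of_all _ fun ξ => ?_) (h.integrable_exp hs)
    (ae_of_all _ fun ξ => by fun_prop)
  rw [norm_mul, norm_exp_neg_I_mul, one_mul, Complex.norm_real, Real.norm_of_nonneg (by positivity)]

theorem setLIntegral_lintegral_comp_add_le (h : IsSymFamily ν ψ) (hf : IsKernel f) (s : ℝ≥0)
    {R : ℝ} {M : ℝ≥0∞} (hM : ∀ a, ∫⁻ y in Metric.closedBall (0 : Rd d) R, f (a + y) ≤ M) :
    ∫⁻ x in Metric.closedBall (0 : Rd d) R, ∫⁻ y, f (x + y) ∂(ν s) ≤ M := by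
  have := h.prob s
  have hfm := hf.measurable
  rw [lintegral_lintegral_swap (by fun_prop)]
  calc ∫⁻ y, ∫⁻ x in Metric.closedBall (0 : Rd d) R, f (x + y) ∂volume ∂(ν s)
      ≤ ∫⁻ y, M ∂(ν s) := lintegral_mono fun y => by
        simpa only [add_comm] using hM y
    _ = M := by simp

/-- Fubini lets each translate of `f` be tested through `μ`; averaging the resulting phases over `ν
s` produces the damping factor. -/
theorem integral_mul_integral_eq (h : IsSymFamily ν ψ) (hf : IsKernel f)
    (hfμ : IsFourierTransformOf f μ) [SFinite μ] {s : ℝ≥0}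
    (hs : ∫⁻ ξ, ENNReal.ofReal (Real.exp (-(2 * s * ψ ξ))) ∂μ < ∞) {g : Rd d → ℝ}
    (hg : ContDiff ℝ (⊤ : ℕ∞) g) (hgc : HasCompactSupport g) :
    ∫ x, (g x : ℂ) * ∫ y, ((f (x + y)).toReal : ℂ) ∂(ν s)
      = ∫ x, (g x : ℂ) * dampedFourier ψ μ s x := by
  have := h.prob s
  have hm : Measurable ψ := h.continuous_exponent.measurable
  have hfm := hf.measurable
  have hgm : Measurable g := hg.continuous.measurable
  have := hfμ.tempered
  obtain ⟨φ, hφ⟩ := exists_schwartz_of_hasCompactSupport hg hgc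
  obtain ⟨R, hR⟩ := hgc.isCompact.isBounded.subset_closedBall (0 : Rd d)
  obtain ⟨A, hA⟩ := hgc.exists_bound_of_continuous hg.continuous
  obtain ⟨M, hM, hMf⟩ := exists_setLIntegral_comp_add_le hf hfμ R
  -- Absolute integrability rests on the bound `M`, uniform over translates of `f`.
  have hint1 : Integrable (Function.uncurry fun x y : Rd d =>
      (g x : ℂ) * ((f (x + y)).toReal : ℂ)) (volume.prod (ν s)) := by
    refine ⟨by fun_prop, ?_⟩
    rw [HasFiniteIntegral, lintegral_prod _ (by fun_prop)]
    calc ∫⁻ x, ∫⁻ y, ‖(g x : ℂ) * ((f (x + y)).toReal : ℂ)‖ₑ ∂(ν s)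
        ≤ ∫⁻ x, (Metric.closedBall (0 : Rd d) R).indicator
            (fun x => ENNReal.ofReal A * ∫⁻ y, f (x + y) ∂(ν s)) x := by
          refine lintegral_mono fun x => ?_
          by_cases hx : x ∈ Metric.closedBall (0 : Rd d) R
          · rw [Set.indicator_of_mem hx, ← lintegral_const_mul _ (by fun_prop)]
            refine lintegral_mono fun y => ?_
            rw [enorm_mul]
            gcongr
            · rw [← ofReal_norm, Complex.norm_real]
              exact ENNReal.ofReal_le_ofReal (hA x)
            · rw [← ofReal_norm, Complex.norm_real,
                Real.norm_of_nonneg ENNReal.toReal_nonneg]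
              exact ENNReal.ofReal_toReal_le
          · have : g x = 0 := image_eq_zero_of_notMem_tsupport fun h' => hx (hR h')
            simp [this]
      _ = ENNReal.ofReal A *
          ∫⁻ x in Metric.closedBall (0 : Rd d) R, ∫⁻ y, f (x + y) ∂(ν s) := by
          rw [lintegral_indicator Metric.isClosed_closedBall.measurableSet, lintegral_const_mul]
          exact Measurable.lintegral_prod_right' (f := fun z : Rd d × Rd d => f (z.1 + z.2))
            (by fun_prop)
      _ ≤ ENNReal.ofReal A * M := by
          gcongr
          exact h.setLIntegral_lintegral_comp_add_le hf s hMf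
      _ < ∞ := ENNReal.mul_lt_top ENNReal.ofReal_lt_top hM
  have hint2 : Integrable (Function.uncurry fun y ξ : Rd d =>
      Complex.exp (-(Complex.I * (⟪ξ, y⟫ : ℝ))) * fourier φ ξ) ((ν s).prod μ) := by
    have hi := (integrable_fourier φ μ).comp_snd (ν s)
    refine hi.mono ?_ (ae_of_all _ fun z => ?_)
    · exact AEStronglyMeasurable.mul (by fun_prop) hi.1
    · simp only [Function.uncurry, norm_mul, norm_exp_neg_I_mul, one_mul, le_refl]
  have hint3 : Integrable (Function.uncurry fun x ξ : Rd d => (g x : ℂ) *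
      (Complex.exp (-(Complex.I * (⟪ξ, x⟫ : ℝ))) * (Real.exp (-(2 * s * ψ ξ)) : ℝ)))
      (volume.prod μ) := by
    have hi := (hg.continuous.integrable_of_hasCompactSupport hgc (μ := volume)).mul_prod
      (h.integrable_exp hs)
    refine hi.mono (by fun_prop) (ae_of_all _ fun z => ?_)
    simp only [Function.uncurry, norm_mul, norm_exp_neg_I_mul, one_mul, Complex.norm_real, le_refl]
  calc ∫ x, (g x : ℂ) * ∫ y, ((f (x + y)).toReal : ℂ) ∂(ν s)
      = ∫ x, ∫ y, (g x : ℂ) * ((f (x + y)).toReal : ℂ) ∂(ν s) := by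
        simp only [integral_const_mul]
    _ = ∫ y, ∫ x, (g x : ℂ) * ((f (x + y)).toReal : ℂ) ∂volume ∂(ν s) := integral_integral_swap hint1
    _ = ∫ y, ∫ ξ, Complex.exp (-(Complex.I * (⟪ξ, y⟫ : ℝ))) * fourier φ ξ ∂μ ∂(ν s) := by
        refine integral_congr_ae (ae_of_all _ fun y => ?_)
        simp only [← hfμ.integral_comp_add φ y, hφ, add_comm, mul_comm]
    _ = ∫ ξ, ∫ y, Complex.exp (-(Complex.I * (⟪ξ, y⟫ : ℝ))) * fourier φ ξ ∂(ν s) ∂μ :=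
        integral_integral_swap hint2
    _ = ∫ ξ, ∫ x, (g x : ℂ) * (Complex.exp (-(Complex.I * (⟪ξ, x⟫ : ℝ))) *
          (Real.exp (-(2 * s * ψ ξ)) : ℝ)) ∂volume ∂μ := by
        refine integral_congr_ae (ae_of_all _ fun ξ => ?_)
        simp only [integral_mul_const, h.integral_exp_neg, fourier, ← mul_assoc]
        rw [mul_comm]
        congr 1
        refine integral_congr_ae (ae_of_all _ fun x => ?_)
        simp only [hφ, mul_comm]
    _ = ∫ x, ∫ ξ, (g x : ℂ) * (Complex.exp (-(Complex.I * (⟪ξ, x⟫ : ℝ))) *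
          (Real.exp (-(2 * s * ψ ξ)) : ℝ)) ∂μ := (integral_integral_swap hint3).symm
    _ = ∫ x, (g x : ℂ) * dampedFourier ψ μ s x := by
        simp only [integral_const_mul, dampedFourier]

/-- Both sides are locally integrable and agree against all test functions; the sign comes from `f ≥
0`. -/
theorem lintegral_comp_add_ae_eq (h : IsSymFamily ν ψ) (hf : IsKernel f)
    (hfμ : IsFourierTransformOf f μ) [SFinite μ] {s : ℝ≥0} (hν : ν s ≪ volume)
    (hs : ∫⁻ ξ, ENNReal.ofReal (Real.exp (-(2 * s * ψ ξ))) ∂μ < ∞) :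
    ∀ᵐ x, ∫⁻ y, f (x + y) ∂(ν s) = ENNReal.ofReal (dampedFourier ψ μ s x).re ∧
      0 ≤ (dampedFourier ψ μ s x).re := by
  have := h.prob s
  have hfm := hf.measurable
  have hvm : Measurable fun x => ∫⁻ y, f (x + y) ∂(ν s) :=
    Measurable.lintegral_prod_right' (f := fun z : Rd d × Rd d => f (z.1 + z.2)) (by fun_prop)
  have hker : IsKernel fun x => ∫⁻ y, f (x + y) ∂(ν s) := by
    refine ⟨hvm, fun K hK => ?_⟩
    obtain ⟨R, hR⟩ := hK.isBounded.subset_closedBall (0 : Rd d)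
    obtain ⟨M, hM, hMf⟩ := exists_setLIntegral_comp_add_le hf hfμ R
    exact (lintegral_mono_set hR).trans_lt
      ((h.setLIntegral_lintegral_comp_add_le hf s hMf).trans_lt hM)
  have hu : ∀ x, ∫ y, ((f (x + y)).toReal : ℂ) ∂(ν s)
      = ((∫⁻ y, f (x + y) ∂(ν s)).toReal : ℂ) := fun x => by
    rw [integral_complex_ofReal, integral_toReal (by fun_prop)]
    -- Absolute continuity makes `f (x + ·)` finite `ν s`-almost everywhere, so `toReal` loses
    -- nothing.
    exact hν.ae_le ((quasiMeasurePreserving_add_left volume x).ae hf.ae_finite)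
  have hloc : LocallyIntegrable (fun x => ((∫⁻ y, f (x + y) ∂(ν s)).toReal : ℂ)) := by
    refine (locallyIntegrable_iff).2 fun K hK => ?_
    exact (integrable_toReal_of_lintegral_ne_top hvm.aemeasurable
      (hker.locally_integrable K hK).ne).ofReal
  have hae := ae_eq_of_integral_contDiff_smul_eq hloc
    (h.continuous_dampedFourier hs).locallyIntegrable fun g hg hgc => by
      have := h.integral_mul_integral_eq hf hfμ hs hg hgc
      simpa only [hu, Complex.real_smul] using this
  filter_upwards [hae, hker.ae_finite] with x hx hx'
  rw [← hx, Complex.ofReal_re]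
  exact ⟨(ENNReal.ofReal_toReal hx'.ne).symm, ENNReal.toReal_nonneg⟩

theorem integral_dampedFourier_comp_add (h : IsSymFamily ν ψ) [SFinite μ] {s : ℝ≥0}
    (hs : ∫⁻ ξ, ENNReal.ofReal (Real.exp (-(2 * s * ψ ξ))) ∂μ < ∞) (x : Rd d) :
    ∫ z, dampedFourier ψ μ s (x + z) ∂(ν s) = dampedFourier ψ μ (s + s) x := by
  have := h.prob s
  have hm : Measurable ψ := h.continuous_exponent.measurable
  have hint : Integrable (Function.uncurry fun z ξ : Rd d =>
      Complex.exp (-(Complex.I * (⟪ξ, x + z⟫ : ℝ))) * (Real.exp (-(2 * s * ψ ξ)) : ℝ))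
      ((ν s).prod μ) := by
    have hi := (h.integrable_exp hs).comp_snd (ν s)
    refine hi.mono (by fun_prop) (ae_of_all _ fun z => ?_)
    simp only [Function.uncurry, norm_mul, norm_exp_neg_I_mul, one_mul, Complex.norm_real, le_refl]
  unfold dampedFourier
  rw [integral_integral_swap hint]
  refine integral_congr_ae (ae_of_all _ fun ξ => ?_)
  have e : ∀ z : Rd d, Complex.exp (-(Complex.I * (⟪ξ, x + z⟫ : ℝ)))
      = Complex.exp (-(Complex.I * (⟪ξ, x⟫ : ℝ))) * Complex.exp (-(Complex.I * (⟪ξ, z⟫ : ℝ))) :=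
    fun z => by
      rw [← Complex.exp_add, inner_add_right]
      push_cast
      ring_nf
  simp only [e, integral_mul_const, integral_const_mul, h.integral_exp_neg]
  rw [mul_assoc, ← Complex.ofReal_mul, ← Real.exp_add]
  congr 3
  push_cast
  ring

/-- Half of the time yields the formula off a null set; the other half averages over `ν s`, which
does not charge that set wherever it is translated. -/
theorem lintegral_comp_add_eq (h : IsSymFamily ν ψ) (hf : IsKernel f)
    (hfμ : IsFourierTransformOf f μ) [SFinite μ] {s : ℝ≥0} (hν : ν s ≪ volume)
    (hs : ∫⁻ ξ, ENNReal.ofReal (Real.exp (-(2 * s * ψ ξ))) ∂μ < ∞) (x : Rd d) :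
    ∫⁻ y, f (x + y) ∂(ν (s + s)) = ENNReal.ofReal (dampedFourier ψ μ (s + s) x).re := by
  have := h.prob s
  have hfm := hf.measurable
  have hae : ∀ᵐ z ∂(ν s), ∫⁻ y, f (x + z + y) ∂(ν s)
      = ENNReal.ofReal (dampedFourier ψ μ s (x + z)).re ∧
        0 ≤ (dampedFourier ψ μ s (x + z)).re :=
    hν.ae_le ((quasiMeasurePreserving_add_left volume x).ae
      (h.lintegral_comp_add_ae_eq hf hfμ hν hs))
  have hi : Integrable (fun z => dampedFourier ψ μ s (x + z)) (ν s) :=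
    Integrable.of_bound ((h.continuous_dampedFourier hs).comp
      (continuous_const.add continuous_id)).aestronglyMeasurable _
      (ae_of_all _ fun z => norm_dampedFourier_le ψ μ s (x + z))
  rw [← h.conv_self, Measure.lintegral_conv (by fun_prop)]
  simp only [← add_assoc]
  rw [lintegral_congr_ae (hae.mono fun z hz => hz.1)]
  refine (ofReal_integral_eq_lintegral_ofReal hi.re (hae.mono fun z hz => hz.2)).symm.trans ?_
  rw [← h.integral_dampedFourier_comp_add hs]
  exact congrArg ENNReal.ofReal (integral_re hi)

theorem ofReal_integral_exp (h : IsSymFamily ν ψ) {s : ℝ≥0}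
    (hs : ∫⁻ ξ, ENNReal.ofReal (Real.exp (-(2 * s * ψ ξ))) ∂μ < ∞) :
    ENNReal.ofReal (∫ ξ, Real.exp (-(2 * s * ψ ξ)) ∂μ)
      = ∫⁻ ξ, ENNReal.ofReal (Real.exp (-(2 * s * ψ ξ))) ∂μ :=
  ofReal_integral_eq_lintegral_ofReal (h.integrable_exp hs) (ae_of_all _ fun _ => by positivity)

end IsSymFamily

/-! ### The law of the symmetrized process. -/

variable {Ω : Type*} [MeasurableSpace Ω] {P : Measure Ω}
  {X : ℝ≥0 → Ω → Rd d} {Ψ : Rd d → ℂ} {f : Rd d → ℝ≥0∞} {μ : Measure (Rd d)}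

/-- The law of the symmetrization `X̄_t`. -/
def symLaw (X : ℝ≥0 → Ω → Rd d) (P : Measure Ω) (t : ℝ≥0) : Measure (Rd d) :=
  (P.prod P).map (symmetrization X t)

theorem measurable_symmetrization (hX : ∀ t, Measurable (X t)) (t : ℝ≥0) :
    Measurable (symmetrization X t) :=
  ((hX t).comp measurable_fst).sub ((hX t).comp measurable_snd)

theorem symSemigroup_eq_lintegral_symLaw (hX : ∀ t, Measurable (X t)) {φ : Rd d → ℝ≥0∞}
    (hφ : Measurable φ) (t : ℝ≥0) (x : Rd d) :
    symSemigroup X P t φ x = ∫⁻ y, φ (x + y) ∂(symLaw X P t) :=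
  (lintegral_map (hφ.comp (measurable_const_add x)) (measurable_symmetrization hX t)).symm

/-- By independence the characteristic function is the squared modulus of `exp(-tΨ)`, so only `Re Ψ`
remains. -/
theorem isSymFamily_symLaw [IsProbabilityMeasure P] (hX : ∀ t, Measurable (X t)) (hΨ : IsCharExponent X P Ψ) :
    IsSymFamily (symLaw X P) fun ξ => (Ψ ξ).re := by
  refine ⟨fun t => Measure.isProbabilityMeasure_map
    (measurable_symmetrization hX t).aemeasurable, fun t ξ => ?_⟩
  have h1 : ∫ ω, Complex.exp (Complex.I * (⟪ξ, X t ω⟫ : ℝ)) ∂P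
      = (starRingEnd ℂ) (Complex.exp (-((t : ℝ) * Ψ ξ))) := by
    rw [← hΨ t ξ, ← integral_conj]
    refine integral_congr_ae (ae_of_all _ fun ω => ?_)
    simp [← Complex.exp_conj]
  rw [charFun_apply, symLaw, integral_map (measurable_symmetrization hX t).aemeasurable
    (by fun_prop)]
  have h2 : ∀ ω : Ω × Ω, Complex.exp ((⟪symmetrization X t ω, ξ⟫ : ℝ) * Complex.I)
      = Complex.exp (Complex.I * (⟪ξ, X t ω.1⟫ : ℝ)) *
        Complex.exp (-(Complex.I * (⟪ξ, X t ω.2⟫ : ℝ))) := fun ω => by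
    rw [← Complex.exp_add, symmetrization, inner_sub_left, real_inner_comm ξ, real_inner_comm ξ]
    push_cast
    ring_nf
  simp only [h2]
  rw [integral_prod_mul (fun ω => Complex.exp (Complex.I * (⟪ξ, X t ω⟫ : ℝ)))
    (fun ω => Complex.exp (-(Complex.I * (⟪ξ, X t ω⟫ : ℝ)))), h1, hΨ t ξ,
    ← Complex.normSq_eq_conj_mul_self, Complex.normSq_eq_norm_sq, Complex.norm_exp,
    ← Real.exp_nat_mul]
  congr 2
  simp [mul_assoc]

/-- The crude bound `ab ≤ a² + b²` suffices, as only finiteness of the constant matters. -/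
theorem symDensity_le (t : ℝ≥0) (z : Rd d) :
    symDensity X P t z ≤ 2 * ∫⁻ x, pdf (X t) P volume x ^ 2 := by
  have hm : Measurable (pdf (X t) P volume) := measurable_pdf _ _ _
  have hle : ∀ a b : ℝ≥0∞, a * b ≤ a ^ 2 + b ^ 2 := fun a b => by
    rcases le_total a b with h | h
    · exact (mul_le_mul_left h b).trans (by rw [← sq]; exact le_add_self)
    · exact (mul_le_mul_right h a).trans (by rw [← sq]; exact le_self_add)
  calc symDensity X P t z
      ≤ ∫⁻ w, (pdf (X t) P volume (z - w) ^ 2 + pdf (X t) P volume (-w) ^ 2) :=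
        lintegral_mono fun w => hle _ _
    _ = 2 * ∫⁻ x, pdf (X t) P volume x ^ 2 := by
        rw [lintegral_add_left (by fun_prop),
          lintegral_sub_left_eq_self (fun x => pdf (X t) P volume x ^ 2) z,
          lintegral_neg_eq_self (f := fun x => pdf (X t) P volume x ^ 2), two_mul]

theorem symLaw_le [IsProbabilityMeasure P] (hX : ∀ t, Measurable (X t)) (t : ℝ≥0) (hp : HasPDF (X t) P volume) :
    symLaw X P t ≤ (2 * ∫⁻ x, pdf (X t) P volume x ^ 2) • volume := by
  refine Measure.le_iff.2 fun A hA => ?_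
  have hi : Measurable (A.indicator (1 : Rd d → ℝ≥0∞)) := measurable_one.indicator hA
  have h1 := symSemigroup_eq_lintegral_symLaw (P := P) hX hi t 0
  simp only [zero_add] at h1
  rw [lintegral_indicator_one hA] at h1
  rw [← h1, symSemigroup_eq X P t (hX t) hp _ hi, Measure.smul_apply, smul_eq_mul, mul_comm,
    ← lintegral_indicator_one hA]
  refine (lintegral_mono fun y => mul_le_mul_right (symDensity_le t _) _).trans_eq ?_
  exact lintegral_mul_const _ hi

theorem lintegral_lintegral_lintegral_rotate {E F G : Type*} [MeasurableSpace E]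
    [MeasurableSpace F] [MeasurableSpace G] {μ : Measure E} {ν : Measure F} {ρ : Measure G}
    [SFinite μ] [SFinite ν] [SFinite ρ] {k : E → F → G → ℝ≥0∞}
    (hk : Measurable fun z : (E × F) × G => k z.1.1 z.1.2 z.2) :
    ∫⁻ x, ∫⁻ y, ∫⁻ z, k x y z ∂ρ ∂ν ∂μ = ∫⁻ y, ∫⁻ z, ∫⁻ x, k x y z ∂μ ∂ρ ∂ν := by
  rw [lintegral_lintegral_swap (Measurable.lintegral_prod_right'
    (f := fun z : (E × F) × G => k z.1.1 z.1.2 z.2) hk).aemeasurable]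
  refine lintegral_congr fun y => ?_
  exact lintegral_lintegral_swap (hk.comp (by fun_prop :
    Measurable fun z : E × G => ((z.1, y), z.2))).aemeasurable

/-! ### The maximum principle for the semigroup and the fractional resolvent. -/

section Semigroup

variable [IsProbabilityMeasure P] (hX : ∀ t, Measurable (X t)) (hΨ : IsCharExponent X P Ψ)
    (hpdf : ∀ t : ℝ≥0, 0 < t → HasPDF (X t) P volume)
    (hL2 : ∀ t : ℝ≥0, 0 < t → ∫⁻ x, pdf (X t) P volume x ^ 2 < ∞)
    (hf : IsKernel f) [SFinite μ] (hfμ : IsFourierTransformOf f μ)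

include hX hΨ hpdf hL2 hfμ

theorem lintegral_exp_exponent_lt_top {t : ℝ≥0} (ht : 0 < t) :
    ∫⁻ ξ, ENNReal.ofReal (Real.exp (-(2 * t * (Ψ ξ).re))) ∂μ < ∞ := by
  obtain ⟨M, hM, hμ⟩ := exists_measure_closedBall_le hfμ
  have h := isSymFamily_symLaw (P := P) hX hΨ
  -- Lebesgue integrability is taken at `t / 2`, because passing to `μ` doubles the time.
  have ht2 : 0 < t / 2 := half_pos ht
  have := h.lintegral_exp_lt_top_of_translation_bounded (t / 2) hM hμ
    (h.lintegral_exp_lt_top (t / 2) _ (ENNReal.mul_lt_top ENNReal.ofNat_lt_top (hL2 _ ht2))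
      (symLaw_le hX _ (hpdf _ ht2)))
  rwa [add_halves] at this

include hf

theorem symSemigroup_eq_dampedFourier {t : ℝ≥0} (ht : 0 < t) (x : Rd d) :
    symSemigroup X P t f x
      = ENNReal.ofReal (dampedFourier (fun ξ => (Ψ ξ).re) μ t x).re := by
  have h := isSymFamily_symLaw (P := P) hX hΨ
  have ht2 : 0 < t / 2 := half_pos ht
  have := h.lintegral_comp_add_eq hf hfμ (s := t / 2)
    (Measure.absolutelyContinuous_of_le_smul (symLaw_le hX _ (hpdf _ ht2)))
    (lintegral_exp_exponent_lt_top hX hΨ hpdf hL2 hfμ ht2) x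
  rwa [add_halves, ← symSemigroup_eq_lintegral_symLaw hX hf.measurable] at this

theorem symSemigroup_zero {t : ℝ≥0} (ht : 0 < t) :
    symSemigroup X P t f 0 = ∫⁻ ξ, ENNReal.ofReal (Real.exp (-(2 * t * (Ψ ξ).re))) ∂μ := by
  rw [symSemigroup_eq_dampedFourier hX hΨ hpdf hL2 hf hfμ ht, dampedFourier_zero, Complex.ofReal_re,
    (isSymFamily_symLaw (P := P) hX hΨ).ofReal_integral_exp
      (lintegral_exp_exponent_lt_top hX hΨ hpdf hL2 hfμ ht)]

theorem symSemigroup_le {t : ℝ≥0} (ht : 0 < t) (x : Rd d) :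
    symSemigroup X P t f x ≤ symSemigroup X P t f 0 := by
  rw [symSemigroup_eq_dampedFourier hX hΨ hpdf hL2 hf hfμ ht x,
    symSemigroup_eq_dampedFourier hX hΨ hpdf hL2 hf hfμ ht 0, dampedFourier_zero,
    Complex.ofReal_re]
  exact ENNReal.ofReal_le_ofReal ((Complex.re_le_norm _).trans (norm_dampedFourier_le _ μ t x))

/-- On the open quadrant `r + s > 0`, so time zero, where the semigroup bound is not available,
never occurs. -/
theorem fracResolvent_le (H α : ℝ) (x : Rd d) :
    fracResolvent X P H α f x ≤ fracResolvent X P H α f 0 := by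
  exact mul_le_mul_right (setLIntegral_mono' measurableSet_Ioi fun s hs =>
    setLIntegral_mono' measurableSet_Ioi fun r hr => mul_le_mul_right
      (symSemigroup_le hX hΨ hpdf hL2 hf hfμ
        (Real.toNNReal_pos.2 (add_pos (Set.mem_Ioi.1 hr) (Set.mem_Ioi.1 hs))) x) _) _

theorem fracResolvent_zero (H α : ℝ) : fracResolvent X P H α f 0 = upsilon Ψ μ H α := by
  have hm : Measurable fun ξ => (Ψ ξ).re :=
    (isSymFamily_symLaw (P := P) hX hΨ).continuous_exponent.measurable
  have hk : Measurable fun z : (Rd d × ℝ) × ℝ => ENNReal.ofReal (|z.2 - z.1.2| ^ (2 * H - 2) *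
      Real.exp (-((α + 2 * (Ψ z.1.1).re) * (z.2 + z.1.2)))) := by
    have : Measurable fun z : (Rd d × ℝ) × ℝ => (Ψ z.1.1).re :=
      hm.comp (measurable_fst.comp measurable_fst)
    fun_prop
  unfold fracResolvent upsilon
  rw [lintegral_lintegral_lintegral_rotate hk]
  congr 1
  refine setLIntegral_congr_fun measurableSet_Ioi fun s hs =>
    setLIntegral_congr_fun measurableSet_Ioi fun r hr => ?_
  have hrs : 0 < r + s := add_pos (Set.mem_Ioi.1 hr) (Set.mem_Ioi.1 hs)
  rw [symSemigroup_zero hX hΨ hpdf hL2 hf hfμ (Real.toNNReal_pos.2 hrs),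
    ← lintegral_const_mul _ (by fun_prop)]
  refine lintegral_congr fun ξ => ?_
  rw [← ENNReal.ofReal_mul (by positivity), mul_assoc, ← Real.exp_add,
    Real.coe_toNNReal _ hrs.le]
  congr 3
  ring

end Semigroup

end FracMax

end

theorem mainTheorem5 {d : ℕ} {Ω : Type*} [MeasurableSpace Ω] (P : Measure Ω)
    [IsProbabilityMeasure P] (X : ℝ≥0 → Ω → FracMax.Rd d) (hX : FracMax.IsLevyProcess X P)
    (Ψ : FracMax.Rd d → ℂ) (hΨ : FracMax.IsCharExponent X P Ψ)
    (hpdf : ∀ t : ℝ≥0, 0 < t → HasPDF (X t) P volume)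
    (hL2 : ∀ t : ℝ≥0, 0 < t → ∫⁻ x, pdf (X t) P volume x ^ 2 < ∞)
    (f : FracMax.Rd d → ℝ≥0∞) (hf : FracMax.IsKernel f)
    (μ : Measure (FracMax.Rd d)) (hfμ : FracMax.IsFourierTransformOf f μ)
    (hμ : ∃ g : FracMax.Rd d → ℝ≥0, Measurable g ∧
      μ = volume.withDensity (fun ξ => (g ξ : ℝ≥0∞)))
    (hf0 : ∀ x, f x < ∞ ↔ x ≠ 0)
    (H : ℝ) (hH : 1 / 2 < H) (α : ℝ) (hα : 0 < α) :
    FracMax.fracResolvent X P H α f 0 = (⨆ x, FracMax.fracResolvent X P H α f x) ∧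
      (⨆ x, FracMax.fracResolvent X P H α f x) = FracMax.upsilon Ψ μ H α := by
  obtain ⟨g, hg, hμg⟩ := hμ
  -- The density provides the s-finiteness needed for the Fubini and Tonelli exchanges.
  have : SFinite μ := by rw [hμg]; infer_instance
  have hsup : (⨆ x, FracMax.fracResolvent X P H α f x) = FracMax.fracResolvent X P H α f 0 :=
    le_antisymm (iSup_le fun x => FracMax.fracResolvent_le hX.measurable hΨ hpdf hL2 hf hfμ H α x)
      (le_iSup (fun x => FracMax.fracResolvent X P H α f x) 0)
  exact ⟨hsup.symm, hsup.trans
    (FracMax.fracResolvent_zero hX.measurable hΨ hpdf hL2 hf hfμ H α)⟩
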